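/- A gyrogroup is a nonempty set $G$ with a binary operation $\oplus$ such that: there is a unique $0\in G$ with $0\oplus x=x=x\oplus 0$ for all $x\in G$; every $x\in G$ has a unique inverse $\ominus x$ with $\ominus x\oplus x=0=x\oplus(\ominus x)$; for all $x,y\in G$ there is an automorphism $\mathrm{gyr}[x,y]$ of $(G,\oplus)$ with $x\oplus(y\oplus z)=(x\oplus y)\oplus \mathrm{gyr}[x,y](z)$ for all $z\in G$; and $\mathrm{gyr}[x\oplus y,y]=\mathrm{gyr}[x,y]$ for all $x,y\in G$. A strongly topological gyrogroup is a gyrogroup $G$ with a topology for which $\oplus\colon G\times G\to G$ and $\ominus\colon G\to G$ are continuous and for which there is a neighborhood base $\mu$ of $0$ such that $\mathrm{gyr}[x,y](U)=U$ for all $U\in\mu$ and all $x,y\in G$. A subgyrogroup of $G$ is a nonempty subset $H$ closed under $\oplus$ such that $H$ is a gyrogroup under the restricted operation and $\mathrm{gyr}[x,y]$ restricts to an automorphism of $H$ for all $x,y\in H$; for $S\subseteq G$, $\langle S\rangle$ denotes the subgyrogroup generated by $S$, i.e. the intersection of all subgyrogroups of $G$ that contain $S$. **Theorem.** Every locally compact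 Hausdorff strongly topological gyrogroup $G$ has a suitable set, that is, a subset $S\subseteq G$ which is discrete in the subspace topology, for which $S\cup\{0\}$ is closed in $G$ and $\langle S\rangle$ is dense in $G$. -/

import Mathlib

/-- A gyrogroup `(G, ⊕)`, written additively. `gyr x y` is an automorphism of the groupoid
`(G, +)`. Uniqueness of the identity and of inverses follows from these axioms
(`Gyrogroup.zero_unique`, `Gyrogroup.neg_unique`), and so does uniqueness of the gyroautomorphisms
(`Gyrogroup.gyr_apply`). -/
class Gyrogroup (G : Type*) extends Add G, Zero G, Neg G where
  /-- the gyroautomorphism `gyr[x, y]` -/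
  gyr : G → G → (G ≃+ G)
  zero_add : ∀ x : G, 0 + x = x
  add_zero : ∀ x : G, x + 0 = x
  neg_add : ∀ x : G, -x + x = 0
  add_neg : ∀ x : G, x + -x = 0
  gyro_assoc : ∀ x y z : G, x + (y + z) = (x + y) + gyr x y z
  loop : ∀ x y : G, gyr (x + y) y = gyr x y

namespace Gyrogroup

theorem zero_unique {G : Type*} [Gyrogroup G] (e : G) (he : ∀ x : G, e + x = x ∧ x + e = x) :
    e = 0 := by
  rw [← add_zero e]
  exact (he 0).1

theorem add_left_inj' {G : Type*} [Gyrogroup G] (x a b : G) (h : x + a = x + b) : a = b := by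
  have h1 := gyro_assoc (-x) x a
  rw [h, gyro_assoc (-x) x b, neg_add, zero_add, zero_add] at h1
  exact ((gyr (-x) x).injective h1).symm

theorem neg_unique {G : Type*} [Gyrogroup G] (x y : G) (h : x + y = 0) : y = -x :=
  add_left_inj' x y (-x) (h.trans (add_neg x).symm)

theorem gyr_zero_apply {G : Type*} [Gyrogroup G] (x z : G) : gyr 0 x z = z := by
  have h := gyro_assoc 0 x z
  rw [zero_add, zero_add] at h
  exact (add_left_inj' x _ _ h).symm

theorem neg_add_cancel_left' {G : Type*} [Gyrogroup G] (x z : G) : -x + (x + z) = z := by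
  rw [gyro_assoc, neg_add, zero_add, ← loop, neg_add, gyr_zero_apply]

theorem neg_neg' {G : Type*} [Gyrogroup G] (x : G) : - -x = x :=
  (neg_unique (-x) x (neg_add x)).symm

theorem add_neg_cancel_left' {G : Type*} [Gyrogroup G] (x z : G) : x + (-x + z) = z := by
  have h := neg_add_cancel_left' (-x) z
  rwa [neg_neg'] at h

theorem gyr_apply {G : Type*} [Gyrogroup G] (x y z : G) :
    gyr x y z = -(x + y) + (x + (y + z)) := by
  rw [gyro_assoc x y z, neg_add_cancel_left']

end Gyrogroup

/-- `H` is a subgyrogroup of `G`: it is nonempty, closed under the operation, each `gyr[x, y]`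
with `x, y ∈ H` restricts to a bijection of `H` (automatically a homomorphism), and `H` with the
restricted operation is a gyrogroup. -/
def IsSubgyrogroup {G : Type*} [Gyrogroup G] (H : Set G) : Prop :=
  H.Nonempty ∧
  (∀ x ∈ H, ∀ y ∈ H, x + y ∈ H) ∧
  (∀ x ∈ H, ∀ y ∈ H, Set.BijOn (Gyrogroup.gyr x y) H H) ∧
  ∃ _ : Gyrogroup H, ∀ x y : H, ((x + y : H) : G) = (x : G) + (y : G)

/-- The subgyrogroup criterion: `IsSubgyrogroup` amounts to being nonempty and closed under the
operation and inverses. -/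
theorem isSubgyrogroup_iff {G : Type*} [Gyrogroup G] (H : Set G) :
    IsSubgyrogroup H ↔
      H.Nonempty ∧ (∀ x ∈ H, ∀ y ∈ H, x + y ∈ H) ∧ (∀ x ∈ H, -x ∈ H) := by
  constructor
  · rintro ⟨hne, hadd, -, inst, hcoe⟩
    refine ⟨hne, hadd, fun x hx => ?_⟩
    have h0 : ((0 : H) : G) = 0 := by
      apply Gyrogroup.add_left_inj' ((0 : H) : G)
      rw [← hcoe, Gyrogroup.add_zero, Gyrogroup.add_zero]
    have h1 : x + ((-(⟨x, hx⟩ : H) : H) : G) = 0 := by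
      rw [← h0, ← Gyrogroup.add_neg (⟨x, hx⟩ : H), hcoe]
    rw [← Gyrogroup.neg_unique _ _ h1]
    exact Subtype.property _
  · rintro ⟨⟨x₀, hx₀⟩, hadd, hneg⟩
    have hzero : (0 : G) ∈ H := by
      rw [← Gyrogroup.add_neg x₀]
      exact hadd _ hx₀ _ (hneg _ hx₀)
    have hbij : ∀ x ∈ H, ∀ y ∈ H, Set.BijOn (Gyrogroup.gyr x y) H H := by
      intro x hx y hy
      refine ⟨fun z hz => ?_, (Gyrogroup.gyr x y).injective.injOn, fun w hw => ?_⟩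
      · rw [Gyrogroup.gyr_apply]
        exact hadd _ (hneg _ (hadd _ hx _ hy)) _ (hadd _ hx _ (hadd _ hy _ hz))
      · refine ⟨-y + (-x + ((x + y) + w)),
          hadd _ (hneg _ hy) _ (hadd _ (hneg _ hx) _ (hadd _ (hadd _ hx _ hy) _ hw)), ?_⟩
        rw [Gyrogroup.gyr_apply, Gyrogroup.add_neg_cancel_left', Gyrogroup.add_neg_cancel_left',
          Gyrogroup.neg_add_cancel_left']
    refine ⟨⟨x₀, hx₀⟩, hadd, hbij, ?_⟩
    let addH : Add H := ⟨fun x y => ⟨x + y, hadd _ x.2 _ y.2⟩⟩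
    refine ⟨{ toAdd := addH
              zero := ⟨0, hzero⟩
              neg := fun x => ⟨-x, hneg _ x.2⟩
              gyr := fun x y =>
                { toEquiv := Set.BijOn.equiv _ (hbij x x.2 y y.2)
                  map_add' := fun a b => Subtype.ext (map_add (Gyrogroup.gyr (x : G) y) _ _) }
              zero_add := fun x => Subtype.ext (Gyrogroup.zero_add _)
              add_zero := fun x => Subtype.ext (Gyrogroup.add_zero _)
              neg_add := fun x => Subtype.ext (Gyrogroup.neg_add _)
              add_neg := fun x => Subtype.ext (Gyrogroup.add_neg _)
              gyro_assoc := fun x y z => Subtype.ext (Gyrogroup.gyro_assoc _ _ _)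
              loop := fun x y => by
                apply AddEquiv.ext
                intro z
                apply Subtype.ext
                exact DFunLike.congr_fun (Gyrogroup.loop (x : G) y) (z : G) }, fun x y => rfl⟩

/-- The subgyrogroup `⟨S⟩` generated by `S`: the intersection of all subgyrogroups containing
`S`. -/
def subgyrogroupClosure {G : Type*} [Gyrogroup G] (S : Set G) : Set G :=
  ⋂₀ {H : Set G | IsSubgyrogroup H ∧ S ⊆ H}

/-- A topological gyrogroup: the operation is jointly continuous and inversion is continuous. -/
class IsTopologicalGyrogroup (G : Type*) [TopologicalSpace G] [Gyrogroup G] : Prop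
    extends ContinuousAdd G, ContinuousNeg G

/-- A strongly topological gyrogroup: there is a neighbourhood base `B` of `0` all of whose
members are invariant under all gyrations. -/
class IsStronglyTopologicalGyrogroup (G : Type*) [TopologicalSpace G] [Gyrogroup G] : Prop
    extends IsTopologicalGyrogroup G where
  exists_basis : ∃ B : Set (Set G), (nhds (0 : G)).HasBasis (fun U => U ∈ B) id ∧
    ∀ U ∈ B, ∀ x y : G, Gyrogroup.gyr x y '' U = U

/-- `S` is a suitable set for `G`: it is discrete in the subspace topology, `S ∪ {0}` is closed in
`G`, and the subgyrogroup generated by `S` is dense in `G`. -/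
structure IsSuitableSet {G : Type*} [TopologicalSpace G] [Gyrogroup G] (S : Set G) : Prop where
  discrete : DiscreteTopology S
  closed : IsClosed (S ∪ {0})
  dense : Dense (subgyrogroupClosure S)

/-!
The argument works inside `G` with small compact subgyrogroups, and never forms a quotient
gyrogroup. Call a set gyration-invariant if all `gyr x y` preserve it. For a gyration-invariant
subgyrogroup `N` the relation `-x + y ∈ N` is an equivalence whose classes are the left cosets
`x + N`; no normality of `N` is needed anywhere.

Fix a compact gyration-invariant neighbourhood `K` of `0`. A `Stage` is an approximate solution: a
compact gyration-invariant subgyrogroup `N` and a union `C` of nontrivial cosets of `N` which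
converge to `N` (all but finitely many are contained in any given open set containing `N`), such
that, for every `D` meeting each coset of `C`, the closure of `⟨D⟩` meets `x + N` for all `x ∈ K`.
A stage with `N = {0}` is a set `C` accumulating only at `0` with `K ⊆ closure ⟨C⟩`.

Such a stage is found by Zorn's lemma, for the order in which a finer stage has a smaller `N`,
keeps exactly one smaller coset inside each old coset, and otherwise adds new cosets only inside the
old `N`.

* Chains have bounds (`Stage.exists_refines_of_isChain`): intersect. Compactness of the cosets
  shows that each of them survives, and that `closure ⟨D⟩` still meets `x + ⋂ N`.
* A stage with `N ≠ {0}` has a proper refinement (`Stage.exists_refines_inter`). Take compact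
  symmetric gyration-invariant neighbourhoods with `V (n + 1) + V (n + 1) ⊆ V n` and `V 0` not
  containing `N`, and pass to `N ∩ ⋂ V n`. In each old coset choose a point lying in every `V n`
  that the coset meets; these choices again converge. Inside `N` add finite sets `F n ⊆ N ∩ V n`
  with `N ∩ V n ⊆ F n + (N ∩ V (n + 2))`, roughly: successive approximation, as in the metrizable
  case, writes every element of `N` as `f₀ + (f₁ + (⋯ + u))` with a small remainder `u`
  (`IsTower.subset_closure_add`).

Finally, a maximal `K`-separated set `T` is closed and discrete with `G = T + K`, so that
`(C ∪ T) \ {0}` is a suitable set.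
-/

open Topology Filter

namespace Gyrogroup

/-- A compact set contains a point lying in every term of a decreasing sequence of closed sets
that the compact set meets: if it meets all of them this is compactness, otherwise a point in the
last term met will do. -/
theorem exists_mem_deepest {X : Type*} [TopologicalSpace X] [T2Space X] {V : ℕ → Set X}
    (hV : Antitone V) (hVc : ∀ n, IsClosed (V n)) {c : Set X} (hc : IsCompact c)
    (hne : c.Nonempty) :
    ∃ x ∈ c, ∀ n, (c ∩ V n).Nonempty → x ∈ V n := by
  classical
  by_cases h : ∀ n, (c ∩ V n).Nonempty
  · obtain ⟨x, hx⟩ := IsCompact.nonempty_iInter_of_sequence_nonempty_isCompact_isClosed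
      (fun n => c ∩ V n) (fun n y hy => ⟨hy.1, hV n.le_succ hy.2⟩) h (hc.inter_right (hVc 0))
      fun n => hc.isClosed.inter (hVc n)
    rw [Set.mem_iInter] at hx
    exact ⟨x, (hx 0).1, fun n _ => (hx n).2⟩
  · push Not at h
    have hlt : ∀ n, (c ∩ V n).Nonempty → n < Nat.find h := fun n hn => by
      by_contra! hle
      obtain ⟨y, hy⟩ := hn
      exact Set.eq_empty_iff_forall_notMem.1 (Nat.find_spec h) y ⟨hy.1, hV hle hy.2⟩
    rcases hm : Nat.find h with _ | m
    · obtain ⟨x, hx⟩ := hne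
      exact ⟨x, hx, fun n hn => absurd (hlt n hn) (by omega)⟩
    · have : (c ∩ V m).Nonempty := by
        rw [Set.nonempty_iff_ne_empty]
        exact Nat.find_min h (by omega)
      obtain ⟨x, hx⟩ := this
      exact ⟨x, hx.1, fun n hn => hV (by have := hlt n hn; omega) hx.2⟩

/-! ### Gyrogroup identities, invariant sets and generated subgyrogroups -/

section Algebra

variable {G : Type*} [Gyrogroup G]

theorem gyr_map_zero (x y : G) : gyr x y 0 = 0 := by
  rw [gyr_apply, add_zero, neg_add]

theorem gyr_map_neg (x y z : G) : gyr x y (-z) = -gyr x y z :=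
  neg_unique _ _ (by rw [← map_add, add_neg, gyr_map_zero])

theorem gyr_symm_apply (x y z : G) : (gyr x y).symm z = -y + (-x + ((x + y) + z)) := by
  rw [AddEquiv.symm_apply_eq, gyr_apply, add_neg_cancel_left', add_neg_cancel_left',
    neg_add_cancel_left']

theorem neg_zero' : -(0 : G) = 0 := (neg_unique 0 0 (add_zero 0)).symm

theorem neg_add_eq_gyr (a b : G) : -(a + b) = gyr a b (-b + -a) := by
  rw [gyr_apply, add_neg_cancel_left', add_neg, add_zero]

/-- A set containing `0`, closed under inversion and preserved by all gyrations. For such `A`, the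
condition `-x + y ∈ A` plays the role of `x` and `y` being `A`-close. -/
structure IsSymmInvariant (A : Set G) : Prop where
  zero_mem : 0 ∈ A
  neg_mem : ∀ x ∈ A, -x ∈ A
  gyr_mem_iff : ∀ x y z, gyr x y z ∈ A ↔ z ∈ A

/-- A subgyrogroup preserved by all gyrations of the ambient gyrogroup. The relation `-x + y ∈ N`
is then an equivalence, with the left cosets of `N` as classes. -/
structure IsInvariantSubgyrogroup (N : Set G) : Prop extends IsSymmInvariant N where
  add_mem : ∀ x ∈ N, ∀ y ∈ N, x + y ∈ N

theorem IsSymmInvariant.self_mem {A : Set G} (hA : IsSymmInvariant A) (x : G) : -x + x ∈ A := by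
  rw [neg_add]
  exact hA.zero_mem

theorem IsSymmInvariant.symm_mem {A : Set G} (hA : IsSymmInvariant A) {x y : G}
    (h : -x + y ∈ A) : -y + x ∈ A := by
  have h1 : -(-y + x) ∈ A := by
    rw [neg_add_eq_gyr, neg_neg', hA.gyr_mem_iff]
    exact h
  simpa only [neg_neg'] using hA.neg_mem _ h1

/-- The triangle inequality for closeness: `A`-close followed by `B`-close is `(A + B)`-close.
Writing `y = x + m` and `z = y + n`, gyroassociativity replaces `n` by a gyration of `n`. -/
theorem IsSymmInvariant.trans_mem {A B C : Set G} (hB : IsSymmInvariant B)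
    (hC : ∀ a ∈ A, ∀ b ∈ B, a + b ∈ C) {x y z : G} (hxy : -x + y ∈ A) (hyz : -y + z ∈ B) :
    -x + z ∈ C := by
  obtain ⟨m, rfl⟩ : ∃ m, x + m = y := ⟨-x + y, add_neg_cancel_left' x y⟩
  obtain ⟨n, rfl⟩ : ∃ n, (x + m) + n = z := ⟨_, add_neg_cancel_left' _ z⟩
  obtain ⟨w, rfl⟩ := (gyr x m).surjective n
  rw [neg_add_cancel_left'] at hxy hyz
  rw [← gyro_assoc, neg_add_cancel_left']
  exact hC _ hxy _ ((hB.gyr_mem_iff _ _ _).1 hyz)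

theorem IsSymmInvariant.neg_add_mem {A : Set G} (hA : IsSymmInvariant A) {s d x : G}
    (h : -d + (-s + x) ∈ A) : -(s + d) + x ∈ A := by
  have h1 : x = (s + d) + gyr s d (-d + (-s + x)) := by
    rw [← gyro_assoc, add_neg_cancel_left', add_neg_cancel_left']
  rw [h1, neg_add_cancel_left']
  exact (hA.gyr_mem_iff _ _ _).2 h

theorem IsSymmInvariant.inter {A B : Set G} (hA : IsSymmInvariant A) (hB : IsSymmInvariant B) :
    IsSymmInvariant (A ∩ B) where
  zero_mem := ⟨hA.zero_mem, hB.zero_mem⟩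
  neg_mem x hx := ⟨hA.neg_mem x hx.1, hB.neg_mem x hx.2⟩
  gyr_mem_iff x y z := and_congr (hA.gyr_mem_iff x y z) (hB.gyr_mem_iff x y z)

theorem IsSymmInvariant.iInter {ι : Sort*} {A : ι → Set G} (hA : ∀ i, IsSymmInvariant (A i)) :
    IsSymmInvariant (⋂ i, A i) where
  zero_mem := Set.mem_iInter.2 fun i => (hA i).zero_mem
  neg_mem x hx := Set.mem_iInter.2 fun i => (hA i).neg_mem x (Set.mem_iInter.1 hx i)
  gyr_mem_iff x y z := by
    simp only [Set.mem_iInter, (hA _).gyr_mem_iff]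

theorem IsInvariantSubgyrogroup.trans_mem {N : Set G} (hN : IsInvariantSubgyrogroup N)
    {x y z : G} (hxy : -x + y ∈ N) (hyz : -y + z ∈ N) : -x + z ∈ N :=
  hN.toIsSymmInvariant.trans_mem hN.add_mem hxy hyz

theorem IsInvariantSubgyrogroup.mem_of_mem {N : Set G} (hN : IsInvariantSubgyrogroup N)
    {x y : G} (hx : x ∈ N) (hxy : -x + y ∈ N) : y ∈ N := by
  have := hN.add_mem _ hx _ hxy
  rwa [add_neg_cancel_left'] at this

theorem IsInvariantSubgyrogroup.setOf_eq {N : Set G} (hN : IsInvariantSubgyrogroup N)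
    {x y : G} (hxy : -x + y ∈ N) : {z | -x + z ∈ N} = {z | -y + z ∈ N} := by
  ext z
  exact ⟨fun h => hN.trans_mem (hN.symm_mem hxy) h, fun h => hN.trans_mem hxy h⟩

theorem isSubgyrogroup_subgyrogroupClosure (S : Set G) :
    IsSubgyrogroup (subgyrogroupClosure S) := by
  rw [isSubgyrogroup_iff]
  refine ⟨⟨0, ?_⟩, ?_, ?_⟩
  · rintro H ⟨hH, -⟩
    obtain ⟨⟨x, hx⟩, hadd, hneg⟩ := (isSubgyrogroup_iff H).1 hH
    rw [← add_neg x]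
    exact hadd _ hx _ (hneg _ hx)
  · intro x hx y hy H hH
    exact ((isSubgyrogroup_iff H).1 hH.1).2.1 _ (hx H hH) _ (hy H hH)
  · intro x hx H hH
    exact ((isSubgyrogroup_iff H).1 hH.1).2.2 _ (hx H hH)

theorem subset_subgyrogroupClosure (S : Set G) : S ⊆ subgyrogroupClosure S :=
  fun _ hx _ hH => hH.2 hx

theorem subgyrogroupClosure_mono {S T : Set G} (h : S ⊆ T) :
    subgyrogroupClosure S ⊆ subgyrogroupClosure T :=
  fun _ hx H hH => hx H ⟨hH.1, h.trans hH.2⟩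

theorem zero_mem_subgyrogroupClosure (S : Set G) : (0 : G) ∈ subgyrogroupClosure S := by
  obtain ⟨⟨x, hx⟩, hadd, hneg⟩ :=
    (isSubgyrogroup_iff _).1 (isSubgyrogroup_subgyrogroupClosure S)
  rw [← add_neg x]
  exact hadd _ hx _ (hneg _ hx)

theorem add_mem_subgyrogroupClosure {S : Set G} {x y : G} (hx : x ∈ subgyrogroupClosure S)
    (hy : y ∈ subgyrogroupClosure S) : x + y ∈ subgyrogroupClosure S :=
  ((isSubgyrogroup_iff _).1 (isSubgyrogroup_subgyrogroupClosure S)).2.1 _ hx _ hy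

/-- A maximal `V`-separated set is a `V`-net. -/
theorem exists_separated_net {V : Set G} (hV : IsSymmInvariant V) :
    ∃ T : Set G, (∀ s ∈ T, ∀ t ∈ T, -s + t ∈ V → s = t) ∧ ∀ x, ∃ t ∈ T, -t + x ∈ V := by
  obtain ⟨T, hT⟩ := zorn_subset {T : Set G | ∀ s ∈ T, ∀ t ∈ T, -s + t ∈ V → s = t} (by
    intro c hc hchain
    refine ⟨⋃₀ c, ?_, fun s hs => Set.subset_sUnion_of_mem hs⟩
    rintro s ⟨A, hA, hsA⟩ t ⟨B, hB, htB⟩ hst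
    rcases hchain.total hA hB with h | h
    · exact hc hB s (h hsA) t htB hst
    · exact hc hA s hsA t (h htB) hst)
  refine ⟨T, hT.prop, fun x => ?_⟩
  by_contra! hx
  have hins : ∀ s ∈ insert x T, ∀ t ∈ insert x T, -s + t ∈ V → s = t := by
    rintro s (rfl | hs) t (rfl | ht) hst
    · rfl
    · exact absurd (hV.symm_mem hst) (hx t ht)
    · exact absurd hst (hx s hs)
    · exact hT.prop s hs t ht hst
  have hxT : x ∈ T := hT.le_of_ge hins (Set.subset_insert x T) (Set.mem_insert x T)
  exact hx x hxT (hV.self_mem x)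

end Algebra

/-! ### Neighbourhoods of zero -/

section Topology

variable {G : Type*} [TopologicalSpace G] [Gyrogroup G]

theorem add_mem_closure_subgyrogroupClosure [ContinuousAdd G] {S : Set G} {x y : G}
    (hx : x ∈ closure (subgyrogroupClosure S)) (hy : y ∈ closure (subgyrogroupClosure S)) :
    x + y ∈ closure (subgyrogroupClosure S) :=
  map_mem_closure₂ continuous_add hx hy fun _ ha _ hb => add_mem_subgyrogroupClosure ha hb

theorem gyr_mem_closure_iff [IsTopologicalGyrogroup G] {U : Set G}
    (hU : ∀ x y z : G, gyr x y z ∈ U ↔ z ∈ U) (x y z : G) :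
    gyr x y z ∈ closure U ↔ z ∈ closure U := by
  let e : G ≃ₜ G :=
    { toEquiv := (gyr x y).toEquiv
      continuous_toFun := by
        change Continuous fun w => gyr x y w
        simp only [gyr_apply]
        fun_prop
      continuous_invFun := by
        change Continuous fun w => (gyr x y).symm w
        simp only [gyr_symm_apply]
        fun_prop }
  have h1 : e ⁻¹' U = U := Set.ext (hU x y)
  have h2 := e.preimage_closure U
  rw [h1] at h2
  exact Set.ext_iff.1 h2 z

/-- Take `closure U ∩ -closure U` for a small gyration-invariant neighbourhood `U`: gyrations are
homeomorphisms, so closures of invariant sets are invariant. -/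
theorem exists_compact_isSymmInvariant [T2Space G] [LocallyCompactSpace G]
    [IsStronglyTopologicalGyrogroup G] {O : Set G} (hO : O ∈ 𝓝 (0 : G)) :
    ∃ V ∈ 𝓝 (0 : G), V ⊆ O ∧ IsCompact V ∧ IsSymmInvariant V := by
  obtain ⟨K, hK, hKO, hKc⟩ := local_compact_nhds hO
  obtain ⟨B, hB, hBinv⟩ := IsStronglyTopologicalGyrogroup.exists_basis (G := G)
  obtain ⟨U, hUB, hUK⟩ := hB.mem_iff.1 hK
  have hU0 : U ∈ 𝓝 (0 : G) := hB.mem_of_mem hUB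
  have hUinv : ∀ x y z : G, gyr x y z ∈ U ↔ z ∈ U := by
    intro x y z
    refine ⟨fun h => ?_, fun h => ?_⟩
    · rw [← hBinv U hUB x y] at h
      exact ((gyr x y).injective.mem_set_image).1 h
    · rw [← hBinv U hUB x y]
      exact Set.mem_image_of_mem _ h
  have hclK : closure U ⊆ K := closure_minimal hUK hKc.isClosed
  have hcl : closure U ∈ 𝓝 (0 : G) := mem_of_superset hU0 subset_closure
  have hneg : (fun x : G => -x) ⁻¹' closure U ∈ 𝓝 (0 : G) := by
    apply continuous_neg.continuousAt
    change closure U ∈ 𝓝 (-(0 : G))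
    rwa [neg_zero']
  refine ⟨closure U ∩ (fun x : G => -x) ⁻¹' closure U, inter_mem hcl hneg,
    fun x hx => hKO (hclK hx.1), ?_, ?_⟩
  · exact hKc.of_isClosed_subset (isClosed_closure.inter (isClosed_closure.preimage continuous_neg))
      fun x hx => hclK hx.1
  · refine ⟨⟨mem_of_mem_nhds hcl, mem_of_mem_nhds hneg⟩, fun x hx => ⟨hx.2, ?_⟩, fun x y z => ?_⟩
    · change - -x ∈ closure U
      rw [neg_neg']
      exact hx.1
    · refine and_congr (gyr_mem_closure_iff hUinv x y z) ?_
      change -gyr x y z ∈ closure U ↔ -z ∈ closure U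
      rw [← gyr_map_neg]
      exact gyr_mem_closure_iff hUinv x y _

theorem exists_add_mem [ContinuousAdd G] {O : Set G} (hO : O ∈ 𝓝 (0 : G)) :
    ∃ W ∈ 𝓝 (0 : G), ∀ a ∈ W, ∀ b ∈ W, a + b ∈ O := by
  have h : (fun p : G × G => p.1 + p.2) ⁻¹' O ∈ 𝓝 ((0 : G), (0 : G)) := by
    apply continuous_add.continuousAt
    change O ∈ 𝓝 ((0 : G) + 0)
    rwa [add_zero]
  rw [nhds_prod_eq] at h
  obtain ⟨W, hW, hWO⟩ := mem_prod_self_iff.1 h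
  exact ⟨W, hW, fun a ha b hb => hWO (Set.mk_mem_prod ha hb)⟩

theorem exists_compact_isSymmInvariant_add_mem [T2Space G] [LocallyCompactSpace G]
    [IsStronglyTopologicalGyrogroup G] {O : Set G} (hO : O ∈ 𝓝 (0 : G)) :
    ∃ V ∈ 𝓝 (0 : G), IsCompact V ∧ IsSymmInvariant V ∧ ∀ a ∈ V, ∀ b ∈ V, a + b ∈ O := by
  obtain ⟨W, hW, hWO⟩ := exists_add_mem hO
  obtain ⟨V, hV, hVW, hVc, hVs⟩ := exists_compact_isSymmInvariant hW
  exact ⟨V, hV, hVc, hVs, fun a ha b hb => hWO _ (hVW ha) _ (hVW hb)⟩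

theorem setOf_neg_add_mem_nhds [ContinuousAdd G] {V : Set G} (hV : V ∈ 𝓝 (0 : G)) (x : G) :
    {y | -x + y ∈ V} ∈ 𝓝 x := by
  have h : Continuous fun y : G => -x + y := by fun_prop
  apply h.continuousAt
  change V ∈ 𝓝 (-x + x)
  rwa [neg_add]

theorem isCompact_setOf_neg_add_mem [ContinuousAdd G] {A : Set G} (hA : IsCompact A) (x : G) :
    IsCompact {y | -x + y ∈ A} := by
  have h : Continuous fun y : G => x + y := by fun_prop
  convert hA.image h using 1
  ext y
  refine ⟨fun hy => ⟨_, hy, add_neg_cancel_left' x y⟩, ?_⟩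
  rintro ⟨a, ha, rfl⟩
  change -x + (x + a) ∈ A
  rwa [neg_add_cancel_left']

/-- If a closed set `Z` meets each translate `x + A i` of a directed family of compact sets, then it
meets `x + ⋂ i, A i`. -/
theorem exists_mem_iInter_neg_add [ContinuousAdd G] [T2Space G] {ι : Type*} [Nonempty ι]
    {A : ι → Set G} (hdir : Directed (· ⊇ ·) A) (hA : ∀ i, IsCompact (A i)) {Z : Set G}
    (hZ : IsClosed Z) {x : G} (h : ∀ i, ∃ y ∈ Z, -x + y ∈ A i) :
    ∃ y ∈ Z, -x + y ∈ ⋂ i, A i := by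
  have hc : ∀ i, IsCompact (Z ∩ {y | -x + y ∈ A i}) := fun i =>
    (isCompact_setOf_neg_add_mem (hA i) x).inter_left hZ
  obtain ⟨y, hy⟩ := IsCompact.nonempty_iInter_of_directed_nonempty_isCompact_isClosed
    (fun i => Z ∩ {y | -x + y ∈ A i})
    (fun i j => by
      obtain ⟨k, hki, hkj⟩ := hdir i j
      exact ⟨k, fun y hy => ⟨hy.1, hki hy.2⟩, fun y hy => ⟨hy.1, hkj hy.2⟩⟩)
    h hc fun i => (hc i).isClosed
  rw [Set.mem_iInter] at hy
  exact ⟨y, (hy (Classical.arbitrary ι)).1, Set.mem_iInter.2 fun i => (hy i).2⟩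

/-! ### Towers of compact invariant sets -/

/-- A sequence of compact symmetric invariant sets with `A (n + 1) + A (n + 1) ⊆ A n`. The terms
need not be neighbourhoods of `0`: a typical example is `N ∩ V n` for a compact invariant
subgyrogroup `N` and neighbourhoods `V n`. The intersection is an invariant subgyrogroup. -/
structure IsTower (A : ℕ → Set G) : Prop where
  isSymmInvariant : ∀ n, IsSymmInvariant (A n)
  isCompact : ∀ n, IsCompact (A n)
  add_mem : ∀ n, ∀ a ∈ A (n + 1), ∀ b ∈ A (n + 1), a + b ∈ A n

namespace IsTower

variable {A : ℕ → Set G}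

theorem antitone (hA : IsTower A) : Antitone A :=
  antitone_nat_of_succ_le fun n a ha => by
    have := hA.add_mem n a ha 0 (hA.isSymmInvariant _).zero_mem
    rwa [add_zero] at this

theorem isInvariantSubgyrogroup (hA : IsTower A) : IsInvariantSubgyrogroup (⋂ n, A n) where
  toIsSymmInvariant := IsSymmInvariant.iInter hA.isSymmInvariant
  add_mem _ hx _ hy := Set.mem_iInter.2 fun n =>
    hA.add_mem n _ (Set.mem_iInter.1 hx _) _ (Set.mem_iInter.1 hy _)

theorem directed (hA : IsTower A) : Directed (· ⊇ ·) A := hA.antitone.directed_ge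

theorem inter (hA : IsTower A) [T2Space G] {N : Set G} (hN : IsInvariantSubgyrogroup N)
    (hNc : IsCompact N) : IsTower fun n => N ∩ A n where
  isSymmInvariant n := hN.toIsSymmInvariant.inter (hA.isSymmInvariant n)
  isCompact n := hNc.inter (hA.isCompact n)
  add_mem n _ ha _ hb := ⟨hN.add_mem _ ha.1 _ hb.1, hA.add_mem n _ ha.2 _ hb.2⟩

theorem exists_subset_of_isOpen [T2Space G] (hA : IsTower A) {U : Set G} (hU : IsOpen U)
    (h : ⋂ n, A n ⊆ U) : ∃ n, A n ⊆ U :=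
  exists_subset_nhds_of_isCompact' hA.directed hA.isCompact (fun n => (hA.isCompact n).isClosed)
    fun _ hx => hU.mem_nhds (h hx)

/-- If `F n ⊆ A n` is finite, then the cosets `f + ⋂ n, A n` with `f ∈ ⋃ n, F n` converge to
`⋂ n, A n`. -/
theorem finite_cosets [T2Space G] (hA : IsTower A) {F : ℕ → Set G} (hFA : ∀ n, F n ⊆ A n)
    (hF : ∀ n, (F n).Finite) {U : Set G} (hU : IsOpen U) (h : ⋂ n, A n ⊆ U) :
    ∃ E : Set G, E.Finite ∧
      ∀ x, x ∉ U → (∃ n, ∃ f ∈ F n, -f + x ∈ ⋂ n, A n) → ∃ f ∈ E, -f + x ∈ ⋂ n, A n := by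
  obtain ⟨n, hn⟩ := hA.exists_subset_of_isOpen hU h
  refine ⟨⋃ k ∈ Set.Iic n, F k, (Set.finite_Iic n).biUnion fun k _ => hF k, ?_⟩
  rintro x hxU ⟨k, f, hf, hfx⟩
  refine ⟨f, Set.mem_biUnion (Set.mem_Iic.2 ?_) hf, hfx⟩
  by_contra! hk
  apply hxU
  apply hn
  have h2 := hA.add_mem n f (hA.antitone hk (hFA k hf)) _ (Set.mem_iInter.1 hfx (n + 1))
  rwa [add_neg_cancel_left'] at h2

/-- Successive approximation. If `F n` is an `A (n + 2)`-net for `A n`, and `D` meets every nontrivial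
coset `f + ⋂ n, A n` with `f ∈ F n`, then the closure of `⟨D⟩` meets `x + ⋂ n, A n` for each
`x ∈ A 0`. The spare index in `n + 2` absorbs the replacement of `f` by an element of `D`. -/
theorem subset_closure_add [T2Space G] [ContinuousAdd G] (hA : IsTower A) {F : ℕ → Set G}
    (hF : ∀ n, ∀ x ∈ A n, ∃ f ∈ F n, -f + x ∈ A (n + 2)) {D : Set G}
    (hD : ∀ n, ∀ f ∈ F n, f ∉ ⋂ n, A n → ∃ d ∈ D, -f + d ∈ ⋂ n, A n) {x : G} (hx : x ∈ A 0) :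
    ∃ y ∈ closure (subgyrogroupClosure D), -x + y ∈ ⋂ n, A n := by
  have hL := hA.isInvariantSubgyrogroup
  have key : ∀ k, ∃ s ∈ subgyrogroupClosure D, -s + x ∈ A k := by
    intro k
    induction k with
    | zero =>
      refine ⟨0, zero_mem_subgyrogroupClosure D, ?_⟩
      rwa [neg_zero', zero_add]
    | succ k ih =>
      obtain ⟨s, hs, hsx⟩ := ih
      obtain ⟨f, hf, hfx⟩ := hF k _ hsx
      obtain ⟨d, hd, hfd⟩ : ∃ d ∈ subgyrogroupClosure D, -f + d ∈ ⋂ n, A n := by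
        by_cases hfL : f ∈ ⋂ n, A n
        · refine ⟨0, zero_mem_subgyrogroupClosure D, ?_⟩
          rw [add_zero]
          exact hL.neg_mem _ hfL
        · obtain ⟨d, hd, hfd⟩ := hD k f hf hfL
          exact ⟨d, subset_subgyrogroupClosure D hd, hfd⟩
      refine ⟨s + d, add_mem_subgyrogroupClosure hs hd,
        (hA.isSymmInvariant _).neg_add_mem ?_⟩
      exact (hA.isSymmInvariant (k + 2)).trans_mem (hA.add_mem (k + 1))
        (Set.mem_iInter.1 (hL.symm_mem hfd) _) hfx
  refine exists_mem_iInter_neg_add hA.directed hA.isCompact isClosed_closure fun k => ?_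
  obtain ⟨s, hs, hsx⟩ := key k
  exact ⟨s, subset_closure hs, (hA.isSymmInvariant k).symm_mem hsx⟩

end IsTower

theorem exists_finite_cover [ContinuousAdd G] {A V : Set G} (hA : IsCompact A)
    (hV : V ∈ 𝓝 (0 : G)) : ∃ F ⊆ A, F.Finite ∧ ∀ x ∈ A, ∃ f ∈ F, -f + x ∈ V := by
  obtain ⟨t, htA, ht⟩ := hA.elim_nhds_subcover (fun f => {y | -f + y ∈ V})
    fun f _ => setOf_neg_add_mem_nhds hV f
  refine ⟨t, htA, t.finite_toSet, fun x hx => ?_⟩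
  obtain ⟨f, hf, hfx⟩ := Set.mem_iUnion₂.1 (ht hx)
  exact ⟨f, hf, hfx⟩

theorem exists_isTower [T2Space G] [LocallyCompactSpace G] [IsStronglyTopologicalGyrogroup G]
    {O : Set G} (hO : O ∈ 𝓝 (0 : G)) :
    ∃ V : ℕ → Set G, IsTower V ∧ V 0 ⊆ O ∧ ∀ n, V n ∈ 𝓝 (0 : G) := by
  obtain ⟨V₀, h₀, h₀O, h₀c, h₀s⟩ := exists_compact_isSymmInvariant hO
  let P := {V : Set G // V ∈ 𝓝 (0 : G) ∧ IsCompact V ∧ IsSymmInvariant V}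
  have step : ∀ V : P, ∃ W : P, ∀ a ∈ W.1, ∀ b ∈ W.1, a + b ∈ V.1 := fun V => by
    obtain ⟨W, h1, h2, h3, h4⟩ := exists_compact_isSymmInvariant_add_mem V.2.1
    exact ⟨⟨W, h1, h2, h3⟩, h4⟩
  choose next hnext using step
  let V : ℕ → P := fun n => Nat.rec ⟨V₀, h₀, h₀c, h₀s⟩ (fun _ W => next W) n
  exact ⟨fun n => (V n).1, ⟨fun n => (V n).2.2.2, fun n => (V n).2.2.1, fun n => hnext (V n)⟩,
    h₀O, fun n => (V n).2.1⟩

/-! ### Stages and their refinement order -/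

variable (G) in
/-- An approximation, modulo a compact invariant subgyrogroup `N`, of a set converging to `0` whose
generated subgyrogroup has closure containing `K`. -/
structure Stage (K : Set G) where
  /-- The subgyrogroup modulo which one works. -/
  N : Set G
  /-- The union of the chosen nontrivial cosets of `N`. -/
  C : Set G
  isInvariantSubgyrogroup : IsInvariantSubgyrogroup N
  isCompact : IsCompact N
  notMem : ∀ a ∈ C, a ∉ N
  saturated : ∀ a ∈ C, ∀ b, -a + b ∈ N → b ∈ C
  /-- The cosets of `C` converge to `N`. -/
  finite_cosets : ∀ U, IsOpen U → N ⊆ U →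
    ∃ E : Set G, E.Finite ∧ ∀ x ∈ C, x ∉ U → ∃ f ∈ E, -f + x ∈ N
  /-- Any set of representatives of the cosets of `C` topologically generates `K` modulo `N`. -/
  generates : ∀ D : Set G, (∀ a ∈ C, ∃ d ∈ D, -a + d ∈ N) →
    ∀ x ∈ K, ∃ y ∈ closure (subgyrogroupClosure D), -x + y ∈ N

namespace Stage

variable {K : Set G}

/-- `q` refines `p`: it works modulo a smaller subgyrogroup, has exactly one coset in each coset of
`p`, and all its other cosets lie in `p.N`. -/
structure Refines (q p : Stage G K) : Prop where
  N_subset : q.N ⊆ p.N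
  C_subset : ∀ x ∈ q.C, x ∈ p.C ∨ x ∈ p.N
  exists_unique : ∀ a ∈ p.C, ∃ b ∈ q.C, -a + b ∈ p.N ∧
    ∀ y ∈ q.C, -a + y ∈ p.N → -b + y ∈ q.N

theorem notMem_of_neg_add_mem (p : Stage G K) {a y : G} (ha : a ∈ p.C) (hy : -a + y ∈ p.N) :
    y ∉ p.N :=
  p.notMem y (p.saturated a ha y hy)

theorem Refines.mem_C {p q : Stage G K} (h : q.Refines p) {a y : G} (ha : a ∈ p.C)
    (hay : -a + y ∈ p.N) (hy : y ∈ q.C ∨ y ∈ q.N) : y ∈ q.C :=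
  hy.resolve_right fun hyN => p.notMem_of_neg_add_mem ha hay (h.N_subset hyN)

theorem Refines.mem_or_mem {p q : Stage G K} (h : q.Refines p) {y : G}
    (hy : y ∈ q.C ∨ y ∈ q.N) : y ∈ p.C ∨ y ∈ p.N :=
  hy.elim (h.C_subset y) fun hy => Or.inr (h.N_subset hy)

theorem Refines.refl (p : Stage G K) : p.Refines p :=
  ⟨subset_rfl, fun _ => Or.inl, fun a ha =>
    ⟨a, ha, p.isInvariantSubgyrogroup.self_mem a, fun _ _ hy => hy⟩⟩

theorem Refines.trans {p q r : Stage G K} (hrq : r.Refines q) (hqp : q.Refines p) :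
    r.Refines p where
  N_subset := hrq.N_subset.trans hqp.N_subset
  C_subset x hx := hqp.mem_or_mem (hrq.C_subset x hx)
  exists_unique a ha := by
    obtain ⟨b, hb, hab, hu⟩ := hqp.exists_unique a ha
    obtain ⟨c, hc, hbc, hv⟩ := hrq.exists_unique b hb
    exact ⟨c, hc, p.isInvariantSubgyrogroup.trans_mem hab (hqp.N_subset hbc), fun y hy hay =>
      hv y hy (hu y (hqp.mem_C ha hay (hrq.C_subset y hy)) hay)⟩

/-! ### Lower bounds of chains -/

section Chain

variable {c : Set (Stage G K)}

/-- The intersection of the subgyrogroups of the stages in `c`. -/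
def chainN (c : Set (Stage G K)) : Set G := ⋂ p : c, p.1.N

/-- The points outside `chainN c` that no stage of `c` excludes: each stage has them in one of its
cosets or has not yet separated them from its subgyrogroup. -/
def chainC (c : Set (Stage G K)) : Set G :=
  {x | (∀ p ∈ c, x ∈ p.C ∨ x ∈ p.N) ∧ x ∉ chainN c}

theorem chainN_subset {p : Stage G K} (hp : p ∈ c) : chainN c ⊆ p.N :=
  Set.iInter_subset (fun p : c => p.1.N) ⟨p, hp⟩

theorem total_of_isChain (hc : IsChain (fun p q => q.Refines p) c) {p q : Stage G K}
    (hp : p ∈ c) (hq : q ∈ c) : q.Refines p ∨ p.Refines q := by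
  by_cases h : p = q
  · subst h
    exact Or.inl (Refines.refl p)
  · exact hc hp hq h

theorem directed_of_isChain (hc : IsChain (fun p q => q.Refines p) c) :
    Directed (· ⊇ ·) fun p : c => p.1.N := by
  intro p q
  rcases total_of_isChain hc p.2 q.2 with h | h
  · exact ⟨q, h.N_subset, subset_rfl⟩
  · exact ⟨p, subset_rfl, h.N_subset⟩

theorem isInvariantSubgyrogroup_chainN (c : Set (Stage G K)) :
    IsInvariantSubgyrogroup (chainN c) where
  toIsSymmInvariant := IsSymmInvariant.iInter fun p => p.1.isInvariantSubgyrogroup.toIsSymmInvariant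
  add_mem _ hx _ hy := Set.mem_iInter.2 fun p =>
    p.1.isInvariantSubgyrogroup.add_mem _ (Set.mem_iInter.1 hx p) _ (Set.mem_iInter.1 hy p)

/-- Each coset of a stage in the chain contains exactly one coset of the intersection: the later
stages cut it down to a directed family of nonempty compact sets. -/
theorem exists_unique_chainC [T2Space G] [ContinuousAdd G]
    (hc : IsChain (fun p q => q.Refines p) c) {p : Stage G K}
    (hp : p ∈ c) {a : G} (ha : a ∈ p.C) : ∃ b ∈ chainC c, -a + b ∈ p.N ∧
      ∀ y ∈ chainC c, -a + y ∈ p.N → -b + y ∈ chainN c := by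
  let I := {q : Stage G K // q ∈ c ∧ q.Refines p}
  have : Nonempty I := ⟨⟨p, hp, Refines.refl p⟩⟩
  choose b hbC hab hbu using fun q : I => q.2.2.exists_unique a ha
  let E : I → Set G := fun q => {y | -b q + y ∈ q.1.N}
  -- for each stage, `E q` is the part of `q.C` inside the coset `a + p.N`
  have hE : ∀ q : I, ∀ y, y ∈ E q ↔ y ∈ q.1.C ∧ -a + y ∈ p.N := fun q y =>
    ⟨fun h => ⟨q.1.saturated _ (hbC q) y h,
      p.isInvariantSubgyrogroup.trans_mem (hab q) (q.2.2.N_subset h)⟩, fun h => hbu q y h.1 h.2⟩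
  have hmono : ∀ q r : I, r.1.Refines q.1 → E r ⊆ E q := by
    intro q r h y hy
    rw [hE] at hy ⊢
    exact ⟨q.2.2.mem_C ha hy.2 (h.C_subset y hy.1), hy.2⟩
  have hEc : ∀ q, IsCompact (E q) := fun q => isCompact_setOf_neg_add_mem q.1.isCompact _
  obtain ⟨z, hz⟩ := IsCompact.nonempty_iInter_of_directed_nonempty_isCompact_isClosed E
    (fun q r => by
      rcases total_of_isChain hc q.2.1 r.2.1 with h | h
      · exact ⟨r, hmono q r h, subset_rfl⟩
      · exact ⟨q, subset_rfl, hmono r q h⟩)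
    (fun q => ⟨b q, q.1.isInvariantSubgyrogroup.self_mem _⟩) hEc fun q => (hEc q).isClosed
  rw [Set.mem_iInter] at hz
  have hzp := (hE ⟨p, hp, Refines.refl p⟩ z).1 (hz _)
  refine ⟨z, ⟨fun q hq => ?_, fun h => p.notMem z hzp.1 (chainN_subset hp h)⟩, hzp.2, ?_⟩
  · rcases total_of_isChain hc hp hq with h | h
    · exact Or.inl ((hE ⟨q, hq, h⟩ z).1 (hz _)).1
    · exact h.C_subset z hzp.1
  · intro y hy hay
    refine Set.mem_iInter.2 fun q => ?_
    have hyp : y ∈ p.C := (Refines.refl p).mem_C ha hay (hy.1 p hp)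
    have key : ∀ r : I, -z + y ∈ r.1.N := fun r =>
      r.1.isInvariantSubgyrogroup.trans_mem (r.1.isInvariantSubgyrogroup.symm_mem (hz r))
        ((hE r y).2 ⟨r.2.2.mem_C ha hay (hy.1 r.1 r.2.1), hay⟩)
    rcases total_of_isChain hc hp q.2 with h | h
    · exact key ⟨q.1, q.2, h⟩
    · exact h.N_subset (key ⟨p, hp, Refines.refl p⟩)

theorem exists_refines_of_isChain [T2Space G] [ContinuousAdd G]
    (hc : IsChain (fun p q => q.Refines p) c) (hne : c.Nonempty) :
    ∃ q : Stage G K, ∀ p ∈ c, q.Refines p := by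
  have : Nonempty c := hne.to_subtype
  have hN := isInvariantSubgyrogroup_chainN c
  obtain ⟨p₀, hp₀⟩ := hne
  refine ⟨{ N := chainN c
            C := chainC c
            isInvariantSubgyrogroup := hN
            isCompact := p₀.isCompact.of_isClosed_subset
              (isClosed_iInter fun p : c => p.1.isCompact.isClosed) (chainN_subset hp₀)
            notMem := fun a ha => ha.2
            saturated := ?_
            finite_cosets := ?_
            generates := ?_ }, fun p hp => ⟨chainN_subset hp, fun x hx => hx.1 p hp,
              fun a ha => exists_unique_chainC hc hp ha⟩⟩
  · intro a ha b hab
    refine ⟨fun p hp => (ha.1 p hp).imp (fun h => p.saturated a h b (chainN_subset hp hab))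
      fun h => p.isInvariantSubgyrogroup.mem_of_mem h (chainN_subset hp hab), fun hb => ?_⟩
    exact ha.2 (hN.mem_of_mem hb (hN.symm_mem hab))
  · intro U hU hNU
    obtain ⟨⟨p, hp⟩, hpU⟩ := exists_subset_nhds_of_isCompact' (directed_of_isChain hc)
      (fun p => p.1.isCompact) (fun p => p.1.isCompact.isClosed)
      (fun x hx => hU.mem_nhds (hNU hx))
    obtain ⟨E, hE, hEC⟩ := p.finite_cosets U hU hpU
    choose! b hbC hab hbu using fun a (ha : a ∈ p.C) => exists_unique_chainC hc hp ha
    refine ⟨b '' E, hE.image b, fun x hx hxU => ?_⟩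
    have hxp : x ∈ p.C := (hx.1 p hp).resolve_right fun h => hxU (hpU h)
    obtain ⟨f, hf, hfx⟩ := hEC x hxp hxU
    exact ⟨b f, Set.mem_image_of_mem b hf, hbu f
      (p.saturated x hxp f (p.isInvariantSubgyrogroup.symm_mem hfx)) x hx hfx⟩
  · intro D hD x hx
    refine exists_mem_iInter_neg_add (directed_of_isChain hc) (fun p => p.1.isCompact)
      isClosed_closure fun p => p.1.generates D (fun a ha => ?_) x hx
    obtain ⟨b, hb, hab, -⟩ := exists_unique_chainC hc p.2 ha
    obtain ⟨d, hd, hbd⟩ := hD b hb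
    exact ⟨d, hd, p.1.isInvariantSubgyrogroup.trans_mem hab (chainN_subset p.2 hbd)⟩

end Chain

/-! ### Refining a single stage -/

/-- A stage can be refined to one whose subgyrogroup is contained in `V 0`. The new subgyrogroup is
`p.N ∩ ⋂ n, V n`; every old coset is replaced by a smaller one that is as close to `0` as possible,
and a sequence of new cosets generating `p.N` is added. -/
theorem exists_refines_inter [T2Space G] [ContinuousAdd G] (p : Stage G K) {V : ℕ → Set G}
    (hV : IsTower V) (hV0 : ∀ n, V n ∈ 𝓝 (0 : G)) :
    ∃ q : Stage G K, q.Refines p ∧ q.N ⊆ V 0 := by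
  have hN := p.isInvariantSubgyrogroup
  -- the tower `p.N, p.N ∩ V 0, p.N ∩ V 1, …`, starting at `p.N` so that all of `p.N` is generated
  let A : ℕ → Set G := fun n => Nat.rec p.N (fun m _ => p.N ∩ V m) n
  have hA : IsTower A := by
    have h := hV.inter hN p.isCompact
    refine ⟨fun n => ?_, fun n => ?_, fun n => ?_⟩
    · cases n with
      | zero => exact hN.toIsSymmInvariant
      | succ n => exact h.isSymmInvariant n
    · cases n with
      | zero => exact p.isCompact
      | succ n => exact h.isCompact n
    · cases n with
      | zero => exact fun a ha b hb => hN.add_mem a ha.1 b hb.1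
      | succ n => exact h.add_mem n
  have hAN : ∀ n, A n ⊆ p.N := fun n => hA.antitone n.zero_le
  have hF : ∀ n, ∃ F ⊆ A n, F.Finite ∧ ∀ x ∈ A n, ∃ f ∈ F, -f + x ∈ A (n + 2) := fun n => by
    obtain ⟨F, hFA, hFf, hF⟩ := exists_finite_cover (hA.isCompact n) (hV0 (n + 1))
    refine ⟨F, hFA, hFf, fun x hx => ?_⟩
    obtain ⟨f, hf, hfx⟩ := hF x hx
    -- `V (n + 1)` suffices, as `-f + x ∈ p.N` is automatic and `A (n + 2) = p.N ∩ V (n + 1)`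
    exact ⟨f, hf, hN.add_mem _ (hN.neg_mem _ (hAN n (hFA hf))) _ (hAN n hx), hfx⟩
  choose F hFA hFf hFcov using hF
  have hL := hA.isInvariantSubgyrogroup
  set L := ⋂ n, A n
  have hLN : L ⊆ p.N := Set.iInter_subset A 0
  have hLV : ∀ n, L ⊆ V n := fun n x hx => (Set.mem_iInter.1 hx (n + 1)).2
  have hσ : ∀ a, ∃ x ∈ {y | -a + y ∈ p.N}, ∀ n, ({y | -a + y ∈ p.N} ∩ V n).Nonempty → x ∈ V n :=
    fun a => exists_mem_deepest hV.antitone (fun n => (hV.isCompact n).isClosed)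
      (isCompact_setOf_neg_add_mem p.isCompact a) ⟨a, hN.self_mem a⟩
  -- choosing from the coset as a set makes the choice independent of its representative
  obtain ⟨σ, hσN, hσV⟩ : ∃ σ : Set G → G, (∀ a, -a + σ {y | -a + y ∈ p.N} ∈ p.N) ∧
      ∀ a n m, -a + m ∈ p.N → m ∈ V n → σ {y | -a + y ∈ p.N} ∈ V n := by
    have h : ∀ c : Set G, ∃ x, ∀ a, c = {y | -a + y ∈ p.N} →
        x ∈ c ∧ ∀ n, (c ∩ V n).Nonempty → x ∈ V n := by
      intro c
      by_cases hc : ∃ a, c = {y | -a + y ∈ p.N}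
      · obtain ⟨a, rfl⟩ := hc
        obtain ⟨x, hx⟩ := hσ a
        exact ⟨x, fun _ _ => hx⟩
      · exact ⟨0, fun a ha => absurd ⟨a, ha⟩ hc⟩
    choose σ h using h
    exact ⟨σ, fun a => (h _ a rfl).1, fun a n m ham hm => (h _ a rfl).2 n ⟨m, ham, hm⟩⟩
  let τ : G → G := fun a => σ {y | -a + y ∈ p.N}
  have hτ : ∀ a b, -a + b ∈ p.N → τ a = τ b := fun a b hab =>
    congrArg σ (hN.setOf_eq hab)
  have hτN : ∀ a x, -τ a + x ∈ L → -a + x ∈ p.N := fun a x h => hN.trans_mem (hσN a) (hLN h)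
  let C' : Set G := {x | (∃ a ∈ p.C, -τ a + x ∈ L) ∨
    (x ∉ L ∧ ∃ n, ∃ f ∈ F n, -f + x ∈ L)}
  have hFN : ∀ x, (∃ n, ∃ f ∈ F n, -f + x ∈ L) → x ∈ p.N := by
    rintro x ⟨n, f, hf, hfx⟩
    exact hN.mem_of_mem (hAN n (hFA n hf)) (hLN hfx)
  have hτC : ∀ a ∈ p.C, τ a ∈ C' := fun a ha => Or.inl ⟨a, ha, hL.self_mem _⟩
  refine ⟨{ N := L
            C := C'
            isInvariantSubgyrogroup := hL
            isCompact := p.isCompact.of_isClosed_subset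
              (isClosed_iInter fun n => (hA.isCompact n).isClosed) hLN
            notMem := ?_
            saturated := ?_
            finite_cosets := ?_
            generates := ?_ }, ⟨hLN, ?_, fun a ha => ⟨τ a, hτC a ha, hσN a, ?_⟩⟩, hLV 0⟩
  · rintro x (⟨a, ha, hax⟩ | h)
    · exact fun hx => p.notMem_of_neg_add_mem ha (hτN a x hax) (hLN hx)
    · exact h.1
  · rintro x (⟨a, ha, hax⟩ | ⟨hxL, n, f, hf, hfx⟩) y hxy
    · exact Or.inl ⟨a, ha, hL.trans_mem hax hxy⟩
    · exact Or.inr ⟨fun hy => hxL (hL.mem_of_mem hy (hL.symm_mem hxy)), n, f, hf,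
        hL.trans_mem hfx hxy⟩
  · intro U hU hLU
    obtain ⟨E, hE, hEF⟩ := hA.finite_cosets hFA hFf hU hLU
    obtain ⟨n, hn⟩ := hA.exists_subset_of_isOpen hU hLU
    -- a coset meeting this open set meets `V (n + 1)`, so its chosen point lies in `V (n + 1)` and
    -- the smaller coset lies in `V n`; outside it only finitely many old cosets contribute
    let W : Set G := (U ∪ (V n)ᶜ) ∩ ⋃ m ∈ p.N, {z | z + m ∈ interior (V (n + 1))}
    have hW : IsOpen W := by
      refine (hU.union (hV.isCompact n).isClosed.isOpen_compl).inter
        (isOpen_biUnion fun m _ => ?_)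
      exact isOpen_interior.preimage (by fun_prop : Continuous fun z : G => z + m)
    have hNW : p.N ⊆ W := by
      intro m hm
      refine ⟨?_, ?_⟩
      · by_cases hmV : m ∈ V n
        · exact Or.inl (hn (hA.antitone n.le_succ ⟨hm, hmV⟩))
        · exact Or.inr hmV
      · refine Set.mem_biUnion (hN.neg_mem m hm) ?_
        change m + -m ∈ interior (V (n + 1))
        rw [add_neg]
        exact mem_interior_iff_mem_nhds.2 (hV0 _)
    obtain ⟨E', hE', hEC⟩ := p.finite_cosets W hW hNW
    refine ⟨E ∪ τ '' E', hE.union (hE'.image τ), ?_⟩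
    rintro x (⟨a, ha, hax⟩ | ⟨-, hx⟩) hxU
    · have hax' := hτN a x hax
      by_cases hxW : x ∈ W
      · exfalso
        obtain ⟨m, hm, hxm⟩ := Set.mem_iUnion₂.1 hxW.2
        have h1 : τ a ∈ V (n + 1) := hσV a (n + 1) (x + m)
          (hN.trans_mem hax' (by rwa [neg_add_cancel_left'])) (interior_subset hxm)
        have h2 := hV.add_mem n _ h1 _ (hLV _ hax)
        rw [add_neg_cancel_left'] at h2
        exact hxW.1.elim hxU fun h => h h2
      · obtain ⟨f, hf, hfx⟩ := hEC x (p.saturated a ha x hax') hxW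
        refine ⟨τ f, Or.inr (Set.mem_image_of_mem τ hf), ?_⟩
        rwa [hτ f a (hN.trans_mem hfx (hN.symm_mem hax'))]
    · obtain ⟨f, hf, hfx⟩ := hEF x hxU hx
      exact ⟨f, Or.inl hf, hfx⟩
  · intro D hD x hx
    obtain ⟨y, hy, hxy⟩ := p.generates D (fun a ha => by
      obtain ⟨d, hd, had⟩ := hD _ (hτC a ha)
      exact ⟨d, hd, hτN a d had⟩) x hx
    obtain ⟨z, hz, hyz⟩ := hA.subset_closure_add hFcov (D := D)
      (fun n f hf hfL => hD f (Or.inr ⟨hfL, n, f, hf, hL.self_mem f⟩)) (hN.symm_mem hxy)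
    refine ⟨y + z, add_mem_closure_subgyrogroupClosure hy hz, hL.symm_mem ?_⟩
    exact hL.neg_add_mem (hL.symm_mem hyz)
  · rintro x (⟨a, ha, hax⟩ | ⟨-, hx⟩)
    · exact Or.inl (p.saturated a ha x (hτN a x hax))
    · exact Or.inr (hFN x hx)
  · rintro y (⟨b, hb, hby⟩ | ⟨-, hy⟩) hay
    · rwa [hτ a b (hN.trans_mem hay (hN.symm_mem (hτN b y hby)))]
    · exact absurd (hFN y hy) (p.notMem_of_neg_add_mem ha hay)

theorem nonempty_of_isTower [T2Space G] [ContinuousAdd G] {V : ℕ → Set G} (hV : IsTower V)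
    (hV0 : ∀ n, V n ∈ 𝓝 (0 : G)) : Nonempty (Stage G (V 0)) := by
  choose F hFV hFf hFcov using fun n => exists_finite_cover (hV.isCompact n) (hV0 (n + 2))
  have hL := hV.isInvariantSubgyrogroup
  refine ⟨{ N := ⋂ n, V n
            C := {x | x ∉ ⋂ n, V n ∧ ∃ n, ∃ f ∈ F n, -f + x ∈ ⋂ n, V n}
            isInvariantSubgyrogroup := hL
            isCompact := (hV.isCompact 0).of_isClosed_subset
              (isClosed_iInter fun n => (hV.isCompact n).isClosed) (Set.iInter_subset V 0)
            notMem := fun a ha => ha.1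
            saturated := ?_
            finite_cosets := ?_
            generates := ?_ }⟩
  · rintro x ⟨hxL, n, f, hf, hfx⟩ y hxy
    exact ⟨fun hy => hxL (hL.mem_of_mem hy (hL.symm_mem hxy)), n, f, hf, hL.trans_mem hfx hxy⟩
  · intro U hU hLU
    obtain ⟨E, hE, hEF⟩ := hV.finite_cosets hFV hFf hU hLU
    exact ⟨E, hE, fun x hx hxU => hEF x hxU hx.2⟩
  · exact fun D hD x hx => hV.subset_closure_add hFcov
      (fun n f hf hfL => hD f ⟨hfL, n, f, hf, hL.self_mem f⟩) hx

end Stage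

/-! ### The suitable set -/

/-- There is a set `C` accumulating only at `0` such that the closure of `⟨C⟩` is a neighbourhood of
`0`: it is the second component of a maximal stage. -/
theorem exists_finite_outside_nhds_generating [T2Space G] [LocallyCompactSpace G]
    [IsStronglyTopologicalGyrogroup G] : ∃ V ∈ 𝓝 (0 : G), IsSymmInvariant V ∧ ∃ C : Set G,
      (0 : G) ∉ C ∧ (∀ U, IsOpen U → (0 : G) ∈ U → (C \ U).Finite) ∧
        V ⊆ closure (subgyrogroupClosure C) := by
  obtain ⟨V, hV, -, hV0⟩ := exists_isTower (G := G) univ_mem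
  have : Nonempty (Stage G (V 0)) := Stage.nonempty_of_isTower hV hV0
  -- maximal for refinement: as `p.N` would shrink when a nonzero point is removed, `p.N = {0}`
  obtain ⟨p, hp⟩ := exists_maximal_of_nonempty_chains_bounded
    (r := fun p q : Stage G (V 0) => q.Refines p)
    (fun c hc hne => Stage.exists_refines_of_isChain hc hne) fun h1 h2 => h2.trans h1
  have hN : ∀ x ∈ p.N, x = 0 := by
    intro x hx
    by_contra hx0
    obtain ⟨W, hW, hWO, hW0⟩ := exists_isTower (isOpen_compl_singleton.mem_nhds (Ne.symm hx0))
    obtain ⟨q, hq, hqW⟩ := p.exists_refines_inter hW hW0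
    exact hWO (hqW ((hp q hq).N_subset hx)) rfl
  have hN' : ∀ x y : G, -x + y ∈ p.N → x = y := fun x y h => by
    have := add_neg_cancel_left' x y
    rwa [hN _ h, add_zero] at this
  refine ⟨V 0, hV0 0, hV.isSymmInvariant 0, p.C,
    fun h => p.notMem 0 h p.isInvariantSubgyrogroup.zero_mem, fun U hU h0 => ?_, fun x hx => ?_⟩
  · obtain ⟨E, hE, hEC⟩ := p.finite_cosets U hU fun x hx => by rwa [hN x hx]
    refine hE.subset fun x hx => ?_
    obtain ⟨f, hf, hfx⟩ := hEC x hx.1 hx.2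
    rwa [← hN' f x hfx]
  · obtain ⟨y, hy, hxy⟩ := p.generates p.C
      (fun a ha => ⟨a, ha, p.isInvariantSubgyrogroup.self_mem a⟩) x hx
    rwa [hN' x y hxy]

theorem isClosed_union_zero_of_locally_finite [T1Space G] {S : Set G}
    (hS : ∀ x ≠ 0, ∃ O ∈ 𝓝 x, (S ∩ O).Finite) : IsClosed (S ∪ {0}) := by
  rw [← isOpen_compl_iff, isOpen_iff_mem_nhds]
  intro x hx
  have hx' : x ∉ S ∧ x ≠ 0 := by simpa [not_or, and_comm] using hx
  obtain ⟨O, hO, hfin⟩ := hS x hx'.2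
  filter_upwards [hO, hfin.isClosed.isOpen_compl.mem_nhds (fun h => hx'.1 h.1),
    isOpen_compl_singleton.mem_nhds hx'.2] with y hy hy1 hy2
  rintro (h | h)
  · exact hy1 ⟨h, hy⟩
  · exact hy2 h

theorem discreteTopology_of_locally_finite [T1Space G] {S : Set G} (h0 : (0 : G) ∉ S)
    (hS : ∀ x ≠ 0, ∃ O ∈ 𝓝 x, (S ∩ O).Finite) : DiscreteTopology S := by
  rw [discreteTopology_subtype_iff]
  intro x hx
  obtain ⟨O, hO, hfin⟩ := hS x (fun h => h0 (h ▸ hx))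
  have h1 : ((S ∩ O) \ {x})ᶜ ∈ 𝓝 x :=
    (hfin.subset Set.sdiff_subset).isClosed.isOpen_compl.mem_nhds fun h => h.2 rfl
  rw [← empty_mem_iff_bot]
  filter_upwards [mem_inf_of_left (mem_nhdsWithin_of_mem_nhds (inter_mem hO h1)),
    mem_inf_of_left self_mem_nhdsWithin, mem_inf_of_right (mem_principal_self S)] with y hy hyx hyS
  exact hy.2 ⟨⟨hyS, hy.1⟩, hyx⟩

end Topology

end Gyrogroup

open Gyrogroup in
theorem theorem21 {G : Type*} [TopologicalSpace G] [T2Space G] [LocallyCompactSpace G]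
    [Gyrogroup G] [IsStronglyTopologicalGyrogroup G] :
    ∃ S : Set G, IsSuitableSet S := by
  obtain ⟨V, hV0, hV, C, hC0, hCfin, hVC⟩ := exists_finite_outside_nhds_generating (G := G)
  obtain ⟨T, hTsep, hTnet⟩ := exists_separated_net hV
  have hlf : ∀ x : G, x ≠ 0 → ∃ O ∈ 𝓝 x, (((C ∪ T) \ {0}) ∩ O).Finite := by
    intro x hx
    obtain ⟨O, U, hO, hU, hxO, h0U, hd⟩ := t2_separation hx
    obtain ⟨W, hW0, -, hW, hWV⟩ := exists_compact_isSymmInvariant_add_mem hV0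
    refine ⟨O ∩ {y | -x + y ∈ W}, inter_mem (hO.mem_nhds hxO) (setOf_neg_add_mem_nhds hW0 x), ?_⟩
    have hT : (T ∩ {y | -x + y ∈ W}).Finite := Set.Subsingleton.finite fun s hs t ht =>
      hTsep s hs.1 t ht.1 (hW.trans_mem hWV (hW.symm_mem hs.2) ht.2)
    refine ((hCfin U hU h0U).union hT).subset ?_
    rintro y ⟨⟨hy | hy, -⟩, hyO, hyW⟩
    · exact Or.inl ⟨hy, Set.disjoint_left.1 hd hyO⟩
    · exact Or.inr ⟨hy, hyW⟩
  refine ⟨(C ∪ T) \ {0}, discreteTopology_of_locally_finite (fun h => h.2 rfl) hlf,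
    isClosed_union_zero_of_locally_finite hlf, fun x => ?_⟩
  obtain ⟨t, ht, htx⟩ := hTnet x
  have hCS : C ⊆ (C ∪ T) \ {0} := fun y hy => ⟨Or.inl hy, fun h => hC0 (h ▸ hy)⟩
  have htS : t ∈ subgyrogroupClosure ((C ∪ T) \ {0}) := by
    by_cases h0 : t = 0
    · rw [h0]
      exact zero_mem_subgyrogroupClosure _
    · exact subset_subgyrogroupClosure _ ⟨Or.inr ht, h0⟩
  rw [← add_neg_cancel_left' t x]
  exact add_mem_closure_subgyrogroupClosure (subset_closure htS)
    (closure_mono (subgyrogroupClosure_mono hCS) (hVC htx))
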